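/- For a field $K$ with $q^2$ elements and $x=(x_1,\ldots,x_k)\in K^k$, let $\mathrm{M}(x)$ be the $k\times k$ circulant matrix with first row $x$, that is, $\mathrm{M}(x)_{ij}=x_{j-i+1}$, and let $H_m(x)=\sum_{i=1}^k x_i x_{i+m}^q$, indices being read modulo $k$. Say that $x$ satisfies condition (*) if $\mathrm{M}(x)$ is non-singular, $\sum_{i=1}^k x_i^{q+1}\neq 0$ and, for all $m=1,\ldots,\lfloor k/2\rfloor$, all $m\times m$ submatrices of $\mathrm{M}(x)$ are non-singular and $H_m(x)=0$. (1) There is an $\epsilon\in\mathbb{F}_{25}$ with $\epsilon^2=\epsilon+3$ and, for every such $\epsilon$, the vector $$x=(1,\epsilon^{14},\epsilon^{21},\epsilon^{16},\epsilon^{17},\epsilon^{17},\epsilon^{16},\epsilon^{21},\epsilon^{14})$$ satisfies condition (*) with $q=5$, $k=9$, and $\mathrm{M}(x)$ is symmetric. (2) There is an $\epsilon\in\mathbb{F}_{49}$ with $\epsilon^2=\epsilon+4$ and, for every such $\epsilon$, the vector $$x=(1,\epsilon^{12},\epsilon^{2},\epsilon^{17},\epsilon^{13},\epsilon^{13},\epsilon^{17},\epsilon^{2},\epsilon^{12})$$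 satisfies condition (*) with $q=7$, $k=9$, and $\mathrm{M}(x)$ is symmetric. (3) Consequently, for $q=5$ and $q=7$ and every $r=0,1,\ldots,8$, there exists an $[\![18-r,r,10-r]\!]_q$ quantum MDS code; in particular (for $r=0$) $[\![18,0,10]\!]_5$ and $[\![18,0,10]\!]_7$ quantum MDS codes exist. Here, for $q=p$ prime, an $[\![n,k,d]\!]_q$ quantum code is a $q^k$-dimensional subspace $Q$ of $(\mathbb{C}^q)^{\otimes n}$ such that $d$ is the least weight of a Pauli error which $Q$ does not detect. A Pauli error is an operator $E=\bigotimes_{i=1}^n X(a_i)Z(b_i)$ with $a_i,b_i\in\mathbb{F}_q$, where $X(a)|x\rangle=|x+a\rangle$ and $Z(b)|x\rangle=e^{2\pi \mathrm{i} bx/p}|x\rangle$ on the orthonormal basis $\{|x\rangle : x\in\mathbb{F}_q\}$ of $\mathbb{C}^q$; its weight is the number of $i$ with $(a_i,b_i)\neq(0,0)$. The code $Q$ detects $E$ if there is a $c\in\mathbb{C}$ with $\langle u,Ev\rangle=c\langle u,v\rangle$ for all $u,v\in Q$, where, if $\dim Q=1$, it is also required (by the usual convention) that $c=0$ whenever $E$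 has positive weight. The code is a quantum MDS code if it attains the quantum Singleton bound, that is, if $k=n-2d+2$. -/

import Mathlib

open scoped Matrix

namespace QuantumMDS

instance factPrimeFive : Fact (Nat.Prime 5) := ⟨by norm_num⟩

instance factPrimeSeven : Fact (Nat.Prime 7) := ⟨by norm_num⟩

section Circulant

/-- The `k × k` circulant matrix with first row `x`: each row is the previous one shifted
cyclically one place to the right, so that the `(i, j)` entry is `x (j - i)`, indices modulo `k`. -/
def circ {K : Type*} {k : ℕ} (x : Fin k → K) : Matrix (Fin k) (Fin k) K :=
  Matrix.of fun i j => x (j - i)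

/-- `H_m(x) = ∑ i, x_i * x_{i+m} ^ q`, the indices read modulo `k`. -/
def hermSum {K : Type*} [Field K] {k : ℕ} [NeZero k] (q m : ℕ) (x : Fin k → K) : K :=
  ∑ i : Fin k, x i * x (i + Fin.ofNat k m) ^ q

/-- The conditions on a circulant matrix with first row `x` over the field `K` with `q ^ 2`
elements: it is non-singular; for `1 ≤ m ≤ k / 2` all its `m × m` submatrices (given by a choice of
`m` rows and `m` columns) are non-singular and `H_m(x) = 0`; and `∑ i, x_i ^ (q + 1) ≠ 0`. -/
structure CirculantCondition {K : Type*} [Field K] {k : ℕ} [NeZero k] (q : ℕ)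
    (x : Fin k → K) : Prop where
  card_eq : Nat.card K = q ^ 2
  det_ne_zero : (circ x).det ≠ 0
  minor_ne_zero : ∀ m : ℕ, 1 ≤ m → m ≤ k / 2 → ∀ r c : Fin m ↪o Fin k,
    ((circ x).submatrix r c).det ≠ 0
  hermSum_eq_zero : ∀ m : ℕ, 1 ≤ m → m ≤ k / 2 → hermSum q m x = 0
  sum_pow_ne_zero : ∑ i, x i ^ (q + 1) ≠ 0

end Circulant

section Quantum

/-! The state space of one `q`-level system has the basis `|x⟩`, `x ∈ F`, where `F` is the field
with `q` elements, of characteristic `p`. The space of `n` systems, the `n`-fold tensor power, has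
the orthonormal basis `|x_1⟩ ⊗ ⋯ ⊗ |x_n⟩`, `x ∈ F ^ n`, and is given in coordinates as
`(Fin n → F) → ℂ`, with the inner product `star u ⬝ᵥ v`. -/

/-- The operator `X(a) : |x⟩ ↦ |x + a⟩`. -/
def pauliX {F : Type*} [Field F] [DecidableEq F] (a : F) : Matrix F F ℂ :=
  Matrix.of fun y x => if y = x + a then 1 else 0

/-- The operator `Z(b) : |x⟩ ↦ exp (2 π i tr(b x) / p) |x⟩`, where `tr` is the trace from `F`
to the prime field. -/
noncomputable def pauliZ (p : ℕ) [NeZero p] {F : Type*} [Field F] [DecidableEq F]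
    [Algebra (ZMod p) F] (b : F) : Matrix F F ℂ :=
  Matrix.diagonal fun x => ZMod.stdAddChar (Algebra.trace (ZMod p) F (b * x))

/-- The Pauli error `X(a_1) Z(b_1) ⊗ ⋯ ⊗ X(a_n) Z(b_n)`, a tensor product of generalised Pauli
operators, as a matrix in the product basis. -/
noncomputable def pauliError (p : ℕ) [NeZero p] {F : Type*} [Field F] [Fintype F] [DecidableEq F]
    [Algebra (ZMod p) F] {n : ℕ} (a b : Fin n → F) : Matrix (Fin n → F) (Fin n → F) ℂ :=
  Matrix.of fun y x => ∏ i, (pauliX (a i) * pauliZ p (b i)) (y i) (x i)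

/-- The weight of a Pauli error: the number of tensor components which are not the identity.
(`X(a) Z(b)` is the identity exactly when `a = b = 0`.) -/
def pauliWeight {F : Type*} [Field F] [DecidableEq F] {n : ℕ} (a b : Fin n → F) : ℕ :=
  (Finset.univ.filter fun i => a i ≠ 0 ∨ b i ≠ 0).card

/-- The code `Q` detects the Pauli error given by `a, b`: if `P` is the orthogonal projection onto
`Q` then `P E P = c P` for some scalar `c`. For a one-dimensional code this holds for every error,
and the usual convention applies: it is required in addition that `c = 0` for errors of positive
weight. -/
def Detects (p : ℕ) [NeZero p] {F : Type*} [Field F] [Fintype F] [DecidableEq F]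
    [Algebra (ZMod p) F] {n : ℕ} (Q : Submodule ℂ ((Fin n → F) → ℂ)) (a b : Fin n → F) : Prop :=
  ∃ c : ℂ, (∀ u ∈ Q, ∀ v ∈ Q, star u ⬝ᵥ (pauliError p a b *ᵥ v) = c * (star u ⬝ᵥ v)) ∧
    (Module.finrank ℂ Q = 1 → 0 < pauliWeight a b → c = 0)

/-- `Q` has minimum distance `d`: the least weight of a Pauli error not detected by `Q` is `d`. -/
def HasMinDist (p : ℕ) [NeZero p] {F : Type*} [Field F] [Fintype F] [DecidableEq F]
    [Algebra (ZMod p) F] {n : ℕ} (Q : Submodule ℂ ((Fin n → F) → ℂ)) (d : ℕ) : Prop :=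
  IsLeast {w : ℕ | ∃ a b : Fin n → F, pauliWeight a b = w ∧ ¬ Detects p Q a b} d

/-- `Q` is an `[[n, k, d]]_q` quantum MDS code, `q = |F|`: it has dimension `q ^ k` and minimum
distance `d`, and it attains the quantum Singleton bound `k ≤ n - 2 d + 2`. -/
structure IsQuantumMDSCode (p : ℕ) [NeZero p] {F : Type*} [Field F] [Fintype F] [DecidableEq F]
    [Algebra (ZMod p) F] {n : ℕ} (Q : Submodule ℂ ((Fin n → F) → ℂ)) (k d : ℕ) : Prop where
  finrank_eq : Module.finrank ℂ Q = Fintype.card F ^ k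
  minDist : HasMinDist p Q d
  singleton_eq : k + 2 * d = n + 2

end Quantum

end QuantumMDS

/-! Since `M = circ x` is symmetric, the vanishing of the `H_m` says that `M̄ M = a • 1`, with `a`
the sum of the norms of the entries. If `u ≠ 0` and `(u, M u)` had weight at most `9`, then `u` or
`M u` would have weight at most `4`, and a small minor of `M` or of its conjugate would vanish. So
all non-zero `(u, M u)` have weight at least `10` (`lt_card_add_card_of_mul_eq_smul_one`). Cyclic
symmetry reduces the minors to those containing row `0` (`circ_minor_ne_zero_of_first_row`). These
are evaluated in the concrete field `QuadRing`, and `CirculantCondition.map` carries the result to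
any root `ε`.

For the quantum codes, write the coordinates of `u` in the basis `1, ω` and those of `M u` in a
basis `1, κ`. The relation `M̄ M = a • 1` makes the code isotropic for the standard symplectic form
over `𝔽_p` when `κ.im = -a`. Here it is the graph of a symmetric matrix `A`, and each non-zero `(s,
A s)` has symplectic weight at least `10` (`lt_graphWeight_fromBlocks`).

A symmetric `A` defines a graph state. Projecting its last `r` systems to the basis states `|z⟩`
gives `p ^ r` vectors, and by `star_graphVec_dotProduct` a Pauli error links two of them only if it
is the visible part of some `(s, A s)`. The projection hides at most `r` positions, so the distance
is at least `10 - r`. An explicit `s` with `(s, A s)` of weight `10` and non-zero at every projected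
position gives equality (`exists_isQuantumMDSCode`). -/

namespace QuantumMDS

/-! ### Kernel-checked minors of a circulant matrix. -/

section Minors

/-- The ring `(ZMod p)[ω]` with `ω ^ 2 = ω + t`. -/
abbrev QuadRing (p t : ℕ) : Type := QuadraticAlgebra (ZMod p) (t : ZMod p) 1

/-- The element `a + b ω`, with natural number coordinates. -/
def QuadRing.ofNats (p t a b : ℕ) : QuadRing p t := ⟨(a : ZMod p), (b : ZMod p)⟩

/-- `f n`, written so that the kernel evaluates `n` before it passes it on to `f`. -/
def evalThen (n : ℕ) (f : ℕ → Bool) : Bool := Nat.rec (f 0) (fun k _ => f (Nat.succ k)) n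

theorem evalThen_eq (n : ℕ) (f : ℕ → Bool) : evalThen n f = f n := by
  cases n <;> rfl

/-- The bounded quantifier `∀ k < n, f k`. -/
def allBelow (n : ℕ) (f : ℕ → Bool) : Bool := Nat.rec true (fun k ih => and (f k) ih) n

theorem allBelow_apply {n : ℕ} {f : ℕ → Bool} (h : allBelow n f = true) {k : ℕ} (hk : k < n) :
    f k = true := by
  induction n with
  | zero => omega
  | succ n ih =>
    have h' : (f n && allBelow n f) = true := h
    rw [Bool.and_eq_true] at h'
    rcases Nat.lt_succ_iff_lt_or_eq.mp hk with hk | rfl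
    · exact ih h'.2 hk
    · exact h'.1

/-- The octal digit of `T` with index `k`. -/
def octDigit (T k : ℕ) : ℕ := Nat.mod (Nat.shiftRight T (Nat.mul 3 k)) 8

/-- Passes the coordinates of the entry with index `k` of a table on to `f`. The tables of first and
second coordinates are given by the octal digits of `S` and `T`. -/
def withEntry (S T k : ℕ) (f : ℕ → ℕ → Bool) : Bool :=
  evalThen (octDigit S k) fun a => evalThen (octDigit T k) fun b => f a b

/-- Passes the coordinates of `x * y - z * w` on to `f`. -/
def withDet₂ (p t x x' y y' z z' w w' : ℕ) (f : ℕ → ℕ → Bool) : Bool :=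
  -- `s` is the coefficient of `ω ^ 2 = ω + t`, so it enters the two coordinates with factors `t`
  -- and `1`. The factor `p - 1` stands for `-1`, which avoids truncated subtraction.
  evalThen (x' * y' + (p - 1) * (z' * w')) fun s =>
  evalThen ((x * y + (p - 1) * (z * w) + t * s) % p) fun a =>
  evalThen ((x * y' + x' * y + (p - 1) * (z * w' + z' * w) + s) % p) fun b => f a b

/-- Passes the coordinates of `x * y - z * w + u * v` on to `f`. -/
def withDet₃ (p t x x' y y' z z' w w' u u' v v' : ℕ) (f : ℕ → ℕ → Bool) : Bool :=
  evalThen (x' * y' + u' * v' + (p - 1) * (z' * w')) fun s =>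
  evalThen ((x * y + u * v + (p - 1) * (z * w) + t * s) % p) fun a =>
  evalThen ((x * y' + x' * y + (u * v' + u' * v) + (p - 1) * (z * w' + z' * w) + s) % p)
    fun b => f a b

/-- Passes the coordinates of `x * X - y * Y + z * Z - w * W` on to `f`. -/
def withDet₄ (p t x x' X X' y y' Y Y' z z' Z Z' w w' W W' : ℕ) (f : ℕ → ℕ → Bool) : Bool :=
  evalThen (x' * X' + z' * Z' + (p - 1) * (y' * Y' + w' * W')) fun s =>
  evalThen ((x * X + z * Z + (p - 1) * (y * Y + w * W) + t * s) % p) fun a =>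
  evalThen ((x * X' + x' * X + (z * Z' + z' * Z) +
    (p - 1) * (y * Y' + y' * Y + (w * W' + w' * W)) + s) % p) fun b => f a b

/-- Whether `a + b ω ≠ 0` for reduced coordinates `a`, `b`. -/
def nonzeroPair (a b : ℕ) : Bool := or (Nat.ble 1 a) (Nat.ble 1 b)

variable {p t : ℕ} {f : ℕ → ℕ → Bool}

open QuadRing (ofNats)

theorem cast_pred (hp : 1 ≤ p) : ((p - 1 : ℕ) : ZMod p) = -1 := by
  rw [Nat.cast_sub hp]; simp

theorem withDet₂_spec (hp : 1 ≤ p) {x x' y y' z z' w w' : ℕ}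
    (h : withDet₂ p t x x' y y' z z' w w' f = true) :
    ∃ a b, a < p ∧ b < p ∧ ofNats p t a b =
      ofNats p t x x' * ofNats p t y y' - ofNats p t z z' * ofNats p t w w' ∧ f a b = true := by
  simp only [withDet₂, evalThen_eq] at h
  refine ⟨_, _, Nat.mod_lt _ hp, Nat.mod_lt _ hp, ?_, h⟩
  ext <;> simp [ofNats, cast_pred hp] <;> ring

theorem withDet₃_spec (hp : 1 ≤ p) {x x' y y' z z' w w' u u' v v' : ℕ}
    (h : withDet₃ p t x x' y y' z z' w w' u u' v v' f = true) :
    ∃ a b, a < p ∧ b < p ∧ ofNats p t a b =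
      ofNats p t x x' * ofNats p t y y' - ofNats p t z z' * ofNats p t w w' +
        ofNats p t u u' * ofNats p t v v' ∧ f a b = true := by
  simp only [withDet₃, evalThen_eq] at h
  refine ⟨_, _, Nat.mod_lt _ hp, Nat.mod_lt _ hp, ?_, h⟩
  ext <;> simp [ofNats, cast_pred hp] <;> ring

theorem withDet₄_spec (hp : 1 ≤ p) {x x' X X' y y' Y Y' z z' Z Z' w w' W W' : ℕ}
    (h : withDet₄ p t x x' X X' y y' Y Y' z z' Z Z' w w' W W' f = true) :
    ∃ a b, a < p ∧ b < p ∧ ofNats p t a b =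
      ofNats p t x x' * ofNats p t X X' - ofNats p t y y' * ofNats p t Y Y' +
        ofNats p t z z' * ofNats p t Z Z' - ofNats p t w w' * ofNats p t W W' ∧ f a b = true := by
  simp only [withDet₄, evalThen_eq] at h
  refine ⟨_, _, Nat.mod_lt _ hp, Nat.mod_lt _ hp, ?_, h⟩
  ext <;> simp [ofNats, cast_pred hp] <;> ring

theorem ofNats_ne_zero {a b : ℕ} (ha : a < p) (hb : b < p) (h : nonzeroPair a b = true) :
    ofNats p t a b ≠ 0 := by
  intro h0
  have h1 : (a : ZMod p) = 0 := congrArg QuadraticAlgebra.re h0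
  have h2 : (b : ZMod p) = 0 := congrArg QuadraticAlgebra.im h0
  rw [ZMod.natCast_eq_zero_iff] at h1 h2
  have := Nat.eq_zero_of_dvd_of_lt h1 ha
  have := Nat.eq_zero_of_dvd_of_lt h2 hb
  subst a b
  simp [nonzeroPair] at h

/-- `S` and `T` are tables of the coordinates of the entries of `x`, repeated once. -/
def IsTable (S T : ℕ) (x : Fin 9 → QuadRing p t) : Prop :=
  -- The index lies between `1` and `17`, so a table of two periods makes reduction modulo `9`
  -- unnecessary.
  ∀ i j : Fin 9, ofNats p t (octDigit S (j + 9 - i)) (octDigit T (j + 9 - i)) = x (j - i)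

theorem withEntry_spec {S T : ℕ} {x : Fin 9 → QuadRing p t} (hx : IsTable S T x) {i j : Fin 9}
    (h : withEntry S T (j + 9 - i) f = true) :
    ∃ a b, ofNats p t a b = circ x i j ∧ f a b = true := by
  simp only [withEntry, evalThen_eq] at h
  exact ⟨_, _, hx i j, h⟩

/-- Checks the `2 × 2` minors with rows `0 < b`. -/
def checkMinors₂ (p t S T : ℕ) : Bool :=
  allBelow 9 fun b => or (Nat.beq b 0) <|
  allBelow 9 fun k₂ =>
  withEntry S T (k₂ + 9 - 0) fun a₂ a₂' => withEntry S T (k₂ + 9 - b) fun b₂ b₂' =>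
  allBelow k₂ fun k₁ =>
  withEntry S T (k₁ + 9 - 0) fun a₁ a₁' => withEntry S T (k₁ + 9 - b) fun b₁ b₁' =>
  withDet₂ p t a₁ a₁' b₂ b₂' a₂ a₂' b₁ b₁' nonzeroPair

/-- Checks the `3 × 3` minors with rows `0 < b < c`. -/
def checkMinors₃ (p t S T : ℕ) : Bool :=
  allBelow 9 fun c => allBelow c fun b => or (Nat.beq b 0) <|
  allBelow 9 fun k₃ =>
  withEntry S T (k₃ + 9 - 0) fun a₃ a₃' => withEntry S T (k₃ + 9 - b) fun b₃ b₃' =>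
  withEntry S T (k₃ + 9 - c) fun c₃ c₃' =>
  allBelow k₃ fun k₂ =>
  withEntry S T (k₂ + 9 - 0) fun a₂ a₂' => withEntry S T (k₂ + 9 - b) fun b₂ b₂' =>
  withEntry S T (k₂ + 9 - c) fun c₂ c₂' =>
  withDet₂ p t a₂ a₂' b₃ b₃' a₃ a₃' b₂ b₂' fun ab ab' =>
  withDet₂ p t a₂ a₂' c₃ c₃' a₃ a₃' c₂ c₂' fun ac ac' =>
  withDet₂ p t b₂ b₂' c₃ c₃' b₃ b₃' c₂ c₂' fun bc bc' =>
  allBelow k₂ fun k₁ =>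
  withEntry S T (k₁ + 9 - 0) fun a₁ a₁' => withEntry S T (k₁ + 9 - b) fun b₁ b₁' =>
  withEntry S T (k₁ + 9 - c) fun c₁ c₁' =>
  withDet₃ p t a₁ a₁' bc bc' b₁ b₁' ac ac' c₁ c₁' ab ab' nonzeroPair

/-- Checks the `4 × 4` minors with rows `0 < b < c < d`. -/
def checkMinors₄ (p t S T : ℕ) : Bool :=
  allBelow 9 fun d => allBelow d fun c => allBelow c fun b => or (Nat.beq b 0) <|
  allBelow 9 fun k₄ =>
  withEntry S T (k₄ + 9 - 0) fun a₄ a₄' => withEntry S T (k₄ + 9 - b) fun b₄ b₄' =>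
  withEntry S T (k₄ + 9 - c) fun c₄ c₄' => withEntry S T (k₄ + 9 - d) fun d₄ d₄' =>
  allBelow k₄ fun k₃ =>
  withEntry S T (k₃ + 9 - 0) fun a₃ a₃' => withEntry S T (k₃ + 9 - b) fun b₃ b₃' =>
  withEntry S T (k₃ + 9 - c) fun c₃ c₃' => withEntry S T (k₃ + 9 - d) fun d₃ d₃' =>
  withDet₂ p t a₃ a₃' b₄ b₄' a₄ a₄' b₃ b₃' fun ab ab' =>
  withDet₂ p t a₃ a₃' c₄ c₄' a₄ a₄' c₃ c₃' fun ac ac' =>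
  withDet₂ p t a₃ a₃' d₄ d₄' a₄ a₄' d₃ d₃' fun ad ad' =>
  withDet₂ p t b₃ b₃' c₄ c₄' b₄ b₄' c₃ c₃' fun bc bc' =>
  withDet₂ p t b₃ b₃' d₄ d₄' b₄ b₄' d₃ d₃' fun bd bd' =>
  withDet₂ p t c₃ c₃' d₄ d₄' c₄ c₄' d₃ d₃' fun cd cd' =>
  allBelow k₃ fun k₂ =>
  withEntry S T (k₂ + 9 - 0) fun a₂ a₂' => withEntry S T (k₂ + 9 - b) fun b₂ b₂' =>
  withEntry S T (k₂ + 9 - c) fun c₂ c₂' => withEntry S T (k₂ + 9 - d) fun d₂ d₂' =>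
  withDet₃ p t b₂ b₂' cd cd' c₂ c₂' bd bd' d₂ d₂' bc bc' fun A A' =>
  withDet₃ p t a₂ a₂' cd cd' c₂ c₂' ad ad' d₂ d₂' ac ac' fun B B' =>
  withDet₃ p t a₂ a₂' bd bd' b₂ b₂' ad ad' d₂ d₂' ab ab' fun C C' =>
  withDet₃ p t a₂ a₂' bc bc' b₂ b₂' ac ac' c₂ c₂' ab ab' fun D D' =>
  allBelow k₂ fun k₁ =>
  withEntry S T (k₁ + 9 - 0) fun a₁ a₁' => withEntry S T (k₁ + 9 - b) fun b₁ b₁' =>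
  withEntry S T (k₁ + 9 - c) fun c₁ c₁' => withEntry S T (k₁ + 9 - d) fun d₁ d₁' =>
  withDet₄ p t a₁ a₁' A A' b₁ b₁' B B' c₁ c₁' C C' d₁ d₁' D D' nonzeroPair

theorem of_or_beq_zero {b : ℕ} {c : Bool} (hb : b ≠ 0) (h : or (Nat.beq b 0) c = true) :
    c = true := by
  cases b with
  | zero => exact absurd rfl hb
  | succ b => exact h

variable {S T : ℕ} {x : Fin 9 → QuadRing p t}

theorem minor₂_ne_zero (hp : 1 ≤ p) (hx : IsTable S T x) (h : checkMinors₂ p t S T = true)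
    {r c : Fin 2 → Fin 9} (hr : StrictMono r) (hc : StrictMono c) (hr0 : r 0 = 0) :
    ((circ x).submatrix r c).det ≠ 0 := by
  have r01 : r 0 < r 1 := hr (by decide)
  have c01 : c 0 < c 1 := hc (by decide)
  have hr0' : ((r 0 : Fin 9) : ℕ) = 0 := by simp [hr0]
  have h := of_or_beq_zero (by omega) (allBelow_apply h (r 1).isLt)
  rw [← hr0'] at h
  have h := allBelow_apply h (c 1).isLt
  obtain ⟨a₂, a₂', ha₂, h⟩ := withEntry_spec hx h
  obtain ⟨b₂, b₂', hb₂, h⟩ := withEntry_spec hx h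
  have h := allBelow_apply h c01
  obtain ⟨a₁, a₁', ha₁, h⟩ := withEntry_spec hx h
  obtain ⟨b₁, b₁', hb₁, h⟩ := withEntry_spec hx h
  obtain ⟨u, v, hu, hv, e, h⟩ := withDet₂_spec hp h
  have := ofNats_ne_zero (t := t) hu hv h
  rw [e, ha₁, ha₂, hb₁, hb₂] at this
  rwa [Matrix.det_fin_two]

theorem minor₃_ne_zero (hp : 1 ≤ p) (hx : IsTable S T x) (h : checkMinors₃ p t S T = true)
    {r c : Fin 3 → Fin 9} (hr : StrictMono r) (hc : StrictMono c) (hr0 : r 0 = 0) :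
    ((circ x).submatrix r c).det ≠ 0 := by
  have r01 : r 0 < r 1 := hr (by decide)
  have r12 : r 1 < r 2 := hr (by decide)
  have c01 : c 0 < c 1 := hc (by decide)
  have c12 : c 1 < c 2 := hc (by decide)
  have hr0' : ((r 0 : Fin 9) : ℕ) = 0 := by simp [hr0]
  have h := of_or_beq_zero (by omega) (allBelow_apply (allBelow_apply h (r 2).isLt) r12)
  rw [← hr0'] at h
  have h := allBelow_apply h (c 2).isLt
  obtain ⟨a₃, a₃', ha₃, h⟩ := withEntry_spec hx h
  obtain ⟨b₃, b₃', hb₃, h⟩ := withEntry_spec hx h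
  obtain ⟨c₃, c₃', hc₃, h⟩ := withEntry_spec hx h
  have h := allBelow_apply h c12
  obtain ⟨a₂, a₂', ha₂, h⟩ := withEntry_spec hx h
  obtain ⟨b₂, b₂', hb₂, h⟩ := withEntry_spec hx h
  obtain ⟨c₂, c₂', hc₂, h⟩ := withEntry_spec hx h
  obtain ⟨ab, ab', -, -, hab, h⟩ := withDet₂_spec hp h
  obtain ⟨ac, ac', -, -, hac, h⟩ := withDet₂_spec hp h
  obtain ⟨bc, bc', -, -, hbc, h⟩ := withDet₂_spec hp h
  have h := allBelow_apply h c01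
  obtain ⟨a₁, a₁', ha₁, h⟩ := withEntry_spec hx h
  obtain ⟨b₁, b₁', hb₁, h⟩ := withEntry_spec hx h
  obtain ⟨c₁, c₁', hc₁, h⟩ := withEntry_spec hx h
  obtain ⟨u, v, hu, hv, e, h⟩ := withDet₃_spec hp h
  have := ofNats_ne_zero (t := t) hu hv h
  rw [e, hab, hac, hbc, ha₁, ha₂, ha₃, hb₁, hb₂, hb₃, hc₁, hc₂, hc₃] at this
  convert this using 1
  rw [Matrix.det_fin_three]
  simp only [Matrix.submatrix_apply]
  ring

/-- Expansion along the leading columns, in the shape of `checkMinors₄`: the minors of the last two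
and the last three columns are shared by all choices of the columns before them. -/
theorem det_fin_four {R : Type*} [CommRing R] (M : Matrix (Fin 4) (Fin 4) R) :
    M.det =
      M 0 0 * (M 1 1 * (M 2 2 * M 3 3 - M 2 3 * M 3 2) - M 2 1 * (M 1 2 * M 3 3 - M 1 3 * M 3 2) +
        M 3 1 * (M 1 2 * M 2 3 - M 1 3 * M 2 2)) -
      M 1 0 * (M 0 1 * (M 2 2 * M 3 3 - M 2 3 * M 3 2) - M 2 1 * (M 0 2 * M 3 3 - M 0 3 * M 3 2) +
        M 3 1 * (M 0 2 * M 2 3 - M 0 3 * M 2 2)) +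
      M 2 0 * (M 0 1 * (M 1 2 * M 3 3 - M 1 3 * M 3 2) - M 1 1 * (M 0 2 * M 3 3 - M 0 3 * M 3 2) +
        M 3 1 * (M 0 2 * M 1 3 - M 0 3 * M 1 2)) -
      M 3 0 * (M 0 1 * (M 1 2 * M 2 3 - M 1 3 * M 2 2) - M 1 1 * (M 0 2 * M 2 3 - M 0 3 * M 2 2) +
        M 2 1 * (M 0 2 * M 1 3 - M 0 3 * M 1 2)) := by
  rw [Matrix.det_succ_column_zero, Fin.sum_univ_four]
  simp only [Matrix.det_fin_three, Matrix.submatrix_apply]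
  simp [Fin.succAbove, Fin.lt_def]
  ring

theorem minor₄_ne_zero (hp : 1 ≤ p) (hx : IsTable S T x) (h : checkMinors₄ p t S T = true)
    {r c : Fin 4 → Fin 9} (hr : StrictMono r) (hc : StrictMono c) (hr0 : r 0 = 0) :
    ((circ x).submatrix r c).det ≠ 0 := by
  have r01 : r 0 < r 1 := hr (by decide)
  have r12 : r 1 < r 2 := hr (by decide)
  have r23 : r 2 < r 3 := hr (by decide)
  have c01 : c 0 < c 1 := hc (by decide)
  have c12 : c 1 < c 2 := hc (by decide)
  have c23 : c 2 < c 3 := hc (by decide)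
  have hr0' : ((r 0 : Fin 9) : ℕ) = 0 := by simp [hr0]
  have h := of_or_beq_zero (by omega)
    (allBelow_apply (allBelow_apply (allBelow_apply h (r 3).isLt) r23) r12)
  rw [← hr0'] at h
  have h := allBelow_apply h (c 3).isLt
  obtain ⟨a₄, a₄', ha₄, h⟩ := withEntry_spec hx h
  obtain ⟨b₄, b₄', hb₄, h⟩ := withEntry_spec hx h
  obtain ⟨c₄, c₄', hc₄, h⟩ := withEntry_spec hx h
  obtain ⟨d₄, d₄', hd₄, h⟩ := withEntry_spec hx h
  have h := allBelow_apply h c23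
  obtain ⟨a₃, a₃', ha₃, h⟩ := withEntry_spec hx h
  obtain ⟨b₃, b₃', hb₃, h⟩ := withEntry_spec hx h
  obtain ⟨c₃, c₃', hc₃, h⟩ := withEntry_spec hx h
  obtain ⟨d₃, d₃', hd₃, h⟩ := withEntry_spec hx h
  obtain ⟨ab, ab', -, -, hab, h⟩ := withDet₂_spec hp h
  obtain ⟨ac, ac', -, -, hac, h⟩ := withDet₂_spec hp h
  obtain ⟨ad, ad', -, -, had, h⟩ := withDet₂_spec hp h
  obtain ⟨bc, bc', -, -, hbc, h⟩ := withDet₂_spec hp h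
  obtain ⟨bd, bd', -, -, hbd, h⟩ := withDet₂_spec hp h
  obtain ⟨cd, cd', -, -, hcd, h⟩ := withDet₂_spec hp h
  have h := allBelow_apply h c12
  obtain ⟨a₂, a₂', ha₂, h⟩ := withEntry_spec hx h
  obtain ⟨b₂, b₂', hb₂, h⟩ := withEntry_spec hx h
  obtain ⟨c₂, c₂', hc₂, h⟩ := withEntry_spec hx h
  obtain ⟨d₂, d₂', hd₂, h⟩ := withEntry_spec hx h
  obtain ⟨A, A', -, -, hA, h⟩ := withDet₃_spec hp h
  obtain ⟨B, B', -, -, hB, h⟩ := withDet₃_spec hp h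
  obtain ⟨C, C', -, -, hC, h⟩ := withDet₃_spec hp h
  obtain ⟨D, D', -, -, hD, h⟩ := withDet₃_spec hp h
  have h := allBelow_apply h c01
  obtain ⟨a₁, a₁', ha₁, h⟩ := withEntry_spec hx h
  obtain ⟨b₁, b₁', hb₁, h⟩ := withEntry_spec hx h
  obtain ⟨c₁, c₁', hc₁, h⟩ := withEntry_spec hx h
  obtain ⟨d₁, d₁', hd₁, h⟩ := withEntry_spec hx h
  obtain ⟨u, v, hu, hv, e, h⟩ := withDet₄_spec hp h
  have := ofNats_ne_zero (t := t) hu hv h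
  rw [e, hA, hB, hC, hD, hab, hac, had, hbc, hbd, hcd, ha₁, ha₂, ha₃, ha₄, hb₁, hb₂, hb₃, hb₄,
    hc₁, hc₂, hc₃, hc₄, hd₁, hd₂, hd₃, hd₄] at this
  rw [det_fin_four]
  exact this

/-- Up to a cyclic shift of the rows and columns, and a permutation of the columns, the first row
of a submatrix of a circulant matrix is row `0`. -/
theorem circ_minor_ne_zero_of_first_row {R : Type*} [CommRing R] {k m : ℕ} [NeZero k]
    {x : Fin k → R}
    (H : ∀ r c : Fin (m + 1) → Fin k, StrictMono r → StrictMono c → r 0 = 0 →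
      ((circ x).submatrix r c).det ≠ 0) {r c : Fin (m + 1) → Fin k} (hr : StrictMono r)
    (hc : Function.Injective c) : ((circ x).submatrix r c).det ≠ 0 := by
  -- The shift may wrap columns around; sorting them again changes the determinant only by a sign.
  let σ := Tuple.sort fun i => c i - r 0
  have hci : Function.Injective fun i => c i - r 0 := fun i j hij => hc (sub_left_injective hij)
  have hcσ : StrictMono ((fun i => c i - r 0) ∘ σ) :=
    (Tuple.monotone_sort _).strictMono_of_injective (hci.comp σ.injective)
  -- No row wraps around, because `r 0` is the least one.
  have hrσ : StrictMono fun i => r i - r 0 := by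
    intro i j hij
    have h0 : r 0 ≤ r i := hr.monotone (Fin.zero_le i)
    have h1 := hr hij
    show r i - r 0 < r j - r 0
    rw [Fin.lt_def, Fin.coe_sub_iff_le.mpr h0, Fin.coe_sub_iff_le.mpr (h0.trans h1.le)]
    omega
  have h := H _ _ hrσ hcσ (sub_self _)
  have e : (circ x).submatrix (fun i => r i - r 0) ((fun i => c i - r 0) ∘ σ) =
      ((circ x).submatrix r c).submatrix id σ := by
    ext i j
    simp [circ]
  rw [e, Matrix.det_permute'] at h
  exact right_ne_zero_of_mul h

end Minors

/-! ### Weights of the vectors `(u, M u)`. -/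

section Weight

variable {K : Type*} [Field K] [DecidableEq K] {k : ℕ}

/-- Otherwise `M u` vanishes in at least as many rows as `u` has non-zero coordinates. A square
submatrix with such rows, and with the support of `u` as columns, then kills a non-zero vector. -/
theorem lt_card_add_card_of_minor_ne_zero {M : Matrix (Fin k) (Fin k) K}
    {u : Fin k → K} (hu : u ≠ 0)
    (hM : ∀ r c : Fin (Finset.univ.filter fun i => u i ≠ 0).card ↪o Fin k,
      (M.submatrix r c).det ≠ 0) :
    k < (Finset.univ.filter fun i => u i ≠ 0).card +
      (Finset.univ.filter fun i => (M *ᵥ u) i ≠ 0).card := by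
  by_contra! hk
  have hz : (Finset.univ.filter fun i => u i ≠ 0).card ≤
      (Finset.univ.filter fun i => (M *ᵥ u) i = 0).card := by
    have := Finset.card_filter_add_card_filter_not (s := Finset.univ) fun i => (M *ᵥ u) i = 0
    rw [Finset.card_univ, Fintype.card_fin] at this
    change _ + (Finset.univ.filter fun i => (M *ᵥ u) i ≠ 0).card = k at this
    omega
  obtain ⟨Z, hZ, hcard⟩ := Finset.exists_subset_card_eq hz
  let r := Z.orderEmbOfFin hcard
  let c := (Finset.univ.filter fun i => u i ≠ 0).orderEmbOfFin rfl
  have h0 : M.submatrix r c *ᵥ (u ∘ c) = 0 := by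
    ext i
    have hi : (M *ᵥ u) (r i) = 0 :=
      (Finset.mem_filter.mp (hZ (Z.orderEmbOfFin_mem hcard i))).2
    refine Eq.trans ?_ hi
    simp only [Matrix.mulVec, dotProduct, Matrix.submatrix_apply, Function.comp_apply]
    rw [← Finset.sum_filter_of_ne (s := Finset.univ) (p := fun i => u i ≠ 0)
      (fun j _ hj => right_ne_zero_of_mul hj),
      ← Finset.sum_image (g := c) (f := fun j => M (r i) j * u j) c.injective.injOn,
      Finset.image_orderEmbOfFin_univ]
  have huc := Matrix.eq_zero_of_mulVec_eq_zero (hM r c) h0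
  obtain ⟨i, hi⟩ := Function.ne_iff.mp hu
  have : i ∈ Set.range c := by
    rw [Finset.range_orderEmbOfFin]; simpa using hi
  obtain ⟨j, rfl⟩ := this
  exact hi (congrFun huc j)

/-- If `M` is invertible, and the small minors of `M` and of its inverse (up to a factor) do not
vanish, then `(u, M u)` has weight more than `k` for all `u ≠ 0`. -/
theorem lt_card_add_card_of_mul_eq_smul_one {M M' : Matrix (Fin k) (Fin k) K} {a : K} (ha : a ≠ 0)
    (h : M' * M = a • 1)
    (hM : ∀ m : ℕ, 1 ≤ m → m ≤ k / 2 → ∀ r c : Fin m ↪o Fin k, (M.submatrix r c).det ≠ 0)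
    (hM' : ∀ m : ℕ, 1 ≤ m → m ≤ k / 2 → ∀ r c : Fin m ↪o Fin k, (M'.submatrix r c).det ≠ 0)
    {u : Fin k → K} (hu : u ≠ 0) :
    k < (Finset.univ.filter fun i => u i ≠ 0).card +
      (Finset.univ.filter fun i => (M *ᵥ u) i ≠ 0).card := by
  have hpos : ∀ {w : Fin k → K}, w ≠ 0 → 1 ≤ (Finset.univ.filter fun i => w i ≠ 0).card := by
    intro w hw
    obtain ⟨i, hi⟩ := Function.ne_iff.mp hw
    exact Finset.card_pos.mpr ⟨i, by simpa using hi⟩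
  by_contra! hk
  have hinv : M' *ᵥ (M *ᵥ u) = a • u := by
    rw [Matrix.mulVec_mulVec, h, Matrix.smul_mulVec, Matrix.one_mulVec]
  have hv : M *ᵥ u ≠ 0 := by
    intro h0
    rw [h0, Matrix.mulVec_zero] at hinv
    exact smul_ne_zero ha hu hinv.symm
  -- One of the two weights is at most `k / 2`. If it is that of `M u`, the roles are exchanged:
  -- `M'` sends `M u` to `a • u`, which has the support of `u`.
  by_cases hle : (Finset.univ.filter fun i => u i ≠ 0).card ≤ k / 2
  · exact (lt_card_add_card_of_minor_ne_zero hu (hM _ (hpos hu) hle)).not_ge hk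
  · have := lt_card_add_card_of_minor_ne_zero hv (hM' _ (hpos hv) (by omega))
    rw [hinv] at this
    simp only [Pi.smul_apply, smul_eq_mul, ne_eq, mul_eq_zero, ha, false_or] at this hk
    omega

end Weight

/-! ### Codes spanned by projected graph states. -/

section GraphCode

variable {p : ℕ} [Fact p.Prime]

theorem stdAddChar_sum {ι : Type*} (s : Finset ι) (f : ι → ZMod p) :
    (ZMod.stdAddChar (∑ i ∈ s, f i) : ℂ) = ∏ i ∈ s, ZMod.stdAddChar (f i) :=
  map_prod (ZMod.stdAddChar (N := p)).toMonoidHom (fun i => Multiplicative.ofAdd (f i)) s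

theorem pauliError_mulVec {n : ℕ} (a b : Fin n → ZMod p) (v : (Fin n → ZMod p) → ℂ)
    (y : Fin n → ZMod p) :
    (pauliError p a b *ᵥ v) y = ZMod.stdAddChar (b ⬝ᵥ (y - a)) * v (y - a) := by
  have h : ∀ x : Fin n → ZMod p, pauliError p a b y x =
      if x = y - a then ZMod.stdAddChar (b ⬝ᵥ (y - a)) else 0 := by
    intro x
    have hi : ∀ i, (pauliX (a i) * pauliZ p (b i)) (y i) (x i) =
        if y i = x i + a i then (ZMod.stdAddChar (b i * x i) : ℂ) else 0 := by
      intro i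
      rw [pauliZ, Matrix.mul_diagonal]
      simp [pauliX]
    simp only [pauliError, Matrix.of_apply, hi]
    split_ifs with hx
    · subst hx
      rw [dotProduct, stdAddChar_sum]
      refine Finset.prod_congr rfl fun i _ => ?_
      simp
    · obtain ⟨i, hi⟩ := Function.ne_iff.mp hx
      refine Finset.prod_eq_zero (Finset.mem_univ i) (if_neg fun h => hi ?_)
      simp [h]
  simp [Matrix.mulVec, dotProduct, h]

/-- Orthogonality of the characters of `(ZMod p) ^ n`. -/
theorem sum_stdAddChar_dotProduct {n : ℕ} (g : Fin n → ZMod p) :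
    ∑ y : Fin n → ZMod p, (ZMod.stdAddChar (g ⬝ᵥ y) : ℂ) = if g = 0 then (p : ℂ) ^ n else 0 := by
  let ψ : AddChar (Fin n → ZMod p) ℂ :=
    (ZMod.stdAddChar (N := p)).compAddMonoidHom
      (dotProductBilin (ZMod p) (ZMod p) g : (Fin n → ZMod p) →ₗ[ZMod p] ZMod p).toAddMonoidHom
  have hψ : ∀ y, ψ y = ZMod.stdAddChar (g ⬝ᵥ y) := fun y => rfl
  simp only [← hψ]
  split_ifs with hg
  · subst hg
    simp [hψ]
  · rw [AddChar.sum_eq_zero_iff_ne_zero]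
    intro h0
    obtain ⟨i, hi⟩ := Function.ne_iff.mp hg
    -- At this point `g ⬝ᵥ y = 1`, where the injective standard character is not `1`.
    have h1 := hψ (Pi.single i (g i)⁻¹)
    rw [h0, AddChar.zero_apply, dotProduct_single, mul_inv_cancel₀ hi,
      ← AddChar.map_zero_eq_one (ZMod.stdAddChar (N := p))] at h1
    exact zero_ne_one (ZMod.injective_stdAddChar h1)

theorem star_stdAddChar (j : ZMod p) :
    star (ZMod.stdAddChar j : ℂ) = ZMod.stdAddChar (-j) := by
  rw [ZMod.stdAddChar_apply, ZMod.stdAddChar_apply, AddChar.map_neg_eq_inv, Circle.coe_inv_eq_conj]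
  rfl

variable {n r : ℕ} (A : Matrix (Fin n ⊕ Fin r) (Fin n ⊕ Fin r) (ZMod p))

/-- The graph state with matrix `A`, with the last `r` systems projected to `|z⟩`. -/
noncomputable def graphVec (z : Fin r → ZMod p) : (Fin n → ZMod p) → ℂ := fun y =>
  ZMod.stdAddChar (2⁻¹ * (Sum.elim y z ⬝ᵥ (A *ᵥ Sum.elim y z)))

/-- The code which is spanned by the projected graph states. -/
noncomputable def graphCode : Submodule ℂ ((Fin n → ZMod p) → ℂ) :=
  Submodule.span ℂ (Set.range (graphVec A))

variable {A}

theorem quadForm_sub (hp : p ≠ 2) (hA : A.IsSymm) (w s : Fin n ⊕ Fin r → ZMod p) :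
    2⁻¹ * ((w - s) ⬝ᵥ (A *ᵥ (w - s))) =
      2⁻¹ * (w ⬝ᵥ (A *ᵥ w)) - (A *ᵥ s) ⬝ᵥ w + 2⁻¹ * (s ⬝ᵥ (A *ᵥ s)) := by
  have h2 : (2 : ZMod p) ≠ 0 := by
    have : ((2 : ℕ) : ZMod p) ≠ 0 := by
      rw [Ne, ZMod.natCast_eq_zero_iff, Nat.prime_dvd_prime_iff_eq Fact.out Nat.prime_two]
      exact hp
    exact_mod_cast this
  have h1 : s ⬝ᵥ (A *ᵥ w) = (A *ᵥ s) ⬝ᵥ w := by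
    rw [Matrix.dotProduct_mulVec, ← Matrix.mulVec_transpose, hA.eq]
  rw [Matrix.mulVec_sub, sub_dotProduct, dotProduct_sub, dotProduct_sub, h1,
    dotProduct_comm w (A *ᵥ s)]
  field_simp
  ring

/-- The matrix entries of a Pauli error between the projected graph states. -/
theorem star_graphVec_dotProduct (hp : p ≠ 2) (hA : A.IsSymm) (a b : Fin n → ZMod p)
    (z z' : Fin r → ZMod p) :
    star (graphVec A z) ⬝ᵥ (pauliError p a b *ᵥ graphVec A z') =
      ZMod.stdAddChar (2⁻¹ * (Sum.elim a (z - z') ⬝ᵥ (A *ᵥ Sum.elim a (z - z'))) - b ⬝ᵥ a -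
        ((A *ᵥ Sum.elim a (z - z')) ∘ Sum.inr) ⬝ᵥ z) *
      if b = (A *ᵥ Sum.elim a (z - z')) ∘ Sum.inl then (p : ℂ) ^ n else 0 := by
  set s := Sum.elim a (z - z') with hs
  -- By polarisation the terms quadratic in `y` cancel, leaving a constant times a linear character
  -- of `y`.
  have key : ∀ y : Fin n → ZMod p,
      star (graphVec A z) y * (pauliError p a b *ᵥ graphVec A z') y =
        ZMod.stdAddChar (2⁻¹ * (s ⬝ᵥ (A *ᵥ s)) - b ⬝ᵥ a - ((A *ᵥ s) ∘ Sum.inr) ⬝ᵥ z) *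
          ZMod.stdAddChar ((b - (A *ᵥ s) ∘ Sum.inl) ⬝ᵥ y) := by
    intro y
    have e : Sum.elim (y - a) z' = Sum.elim y z - s := by
      rw [hs, ← Sum.elim_sub_sub, sub_sub_cancel]
    have e2 : (A *ᵥ s) ⬝ᵥ Sum.elim y z =
        ((A *ᵥ s) ∘ Sum.inl) ⬝ᵥ y + ((A *ᵥ s) ∘ Sum.inr) ⬝ᵥ z := by
      simp [dotProduct]
    rw [pauliError_mulVec, Pi.star_apply, graphVec, graphVec, star_stdAddChar,
      ← AddChar.map_add_eq_mul, ← AddChar.map_add_eq_mul, ← AddChar.map_add_eq_mul, e,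
      quadForm_sub hp hA, e2, dotProduct_sub, sub_dotProduct]
    congr 1
    ring
  rw [dotProduct, Finset.sum_congr rfl fun y _ => key y, ← Finset.mul_sum,
    sum_stdAddChar_dotProduct]
  simp only [sub_eq_zero]

/-- The number of `i` with `s i ≠ 0` or `(A s) i ≠ 0`. -/
def graphWeight {ι : Type*} [Fintype ι] (A : Matrix ι ι (ZMod p)) (s : ι → ZMod p) : ℕ :=
  (Finset.univ.filter fun i => s i ≠ 0 ∨ (A *ᵥ s) i ≠ 0).card

theorem graphWeight_sum (s : Fin n ⊕ Fin r → ZMod p) :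
    graphWeight A s = pauliWeight (s ∘ Sum.inl) ((A *ᵥ s) ∘ Sum.inl) +
      pauliWeight (s ∘ Sum.inr) ((A *ᵥ s) ∘ Sum.inr) := by
  simp only [graphWeight, pauliWeight, Finset.card_filter, Fintype.sum_sum_type,
    Function.comp_apply]

theorem pauliWeight_le (a b : Fin r → ZMod p) : pauliWeight a b ≤ r :=
  (Finset.card_filter_le _ _).trans (by simp)

theorem pauliError_zero : pauliError p (0 : Fin n → ZMod p) 0 = 1 := by
  refine Matrix.ext_of_mulVec_single fun x => ?_
  ext y
  rw [pauliError_mulVec, Matrix.mulVec_single_one]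
  simp [Matrix.one_apply, Pi.single_apply]

theorem pauliWeight_eq_zero {a b : Fin n → ZMod p} (h : pauliWeight a b = 0) : a = 0 ∧ b = 0 := by
  rw [pauliWeight, Finset.card_eq_zero, Finset.filter_eq_empty_iff] at h
  constructor <;> ext i <;> have := @h i (Finset.mem_univ i) <;> tauto

variable {d : ℕ}

/-- A non-zero overlap would make `(a, b)` the left part of `(s, A s)` for the non-zero `s = (a, z -
z')`. At most `r` of its weight, which is at least `d + r`, lies on the right, so `(a, b)` would
have weight at least `d`. The case `a = b = 0` is the orthogonality of the spanning vectors. -/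
theorem star_graphVec_dotProduct_eq_zero (hp : p ≠ 2) (hA : A.IsSymm)
    (hd : ∀ s, s ≠ 0 → d + r ≤ graphWeight A s) {a b : Fin n → ZMod p}
    (hw : pauliWeight a b < d) {z z' : Fin r → ZMod p} (h : 0 < pauliWeight a b ∨ z ≠ z') :
    star (graphVec A z) ⬝ᵥ (pauliError p a b *ᵥ graphVec A z') = 0 := by
  rw [star_graphVec_dotProduct hp hA, if_neg, mul_zero]
  intro hb
  have hs : Sum.elim a (z - z') ≠ 0 := by
    intro h0
    rw [h0] at hb
    have ha : a = 0 := funext fun i => congrFun h0 (Sum.inl i)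
    have hz : z - z' = 0 := funext fun i => congrFun h0 (Sum.inr i)
    rcases h with h | h
    · rw [ha, hb] at h
      simp [pauliWeight] at h
    · exact h (sub_eq_zero.mp hz)
  have h1 := hd _ hs
  rw [graphWeight_sum, ← hb, Sum.elim_comp_inl] at h1
  have := pauliWeight_le (Sum.elim a (z - z') ∘ Sum.inr)
    ((A *ᵥ Sum.elim a (z - z')) ∘ Sum.inr)
  omega

theorem star_graphVec_dotProduct_self (z : Fin r → ZMod p) :
    star (graphVec A z) ⬝ᵥ graphVec A z = (p : ℂ) ^ n := by
  have : ∀ y, star (graphVec A z) y * graphVec A z y = 1 := fun y => by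
    rw [Pi.star_apply, graphVec, star_stdAddChar, ← AddChar.map_add_eq_mul, neg_add_cancel,
      AddChar.map_zero_eq_one]
  rw [dotProduct, Finset.sum_congr rfl fun y _ => this y]
  simp

theorem finrank_graphCode (hp : p ≠ 2) (hA : A.IsSymm) (hd0 : 0 < d)
    (hd : ∀ s, s ≠ 0 → d + r ≤ graphWeight A s) :
    Module.finrank ℂ (graphCode A) = p ^ r := by
  have hpow : (p : ℂ) ^ n ≠ 0 := pow_ne_zero _ (Nat.cast_ne_zero.mpr (NeZero.ne p))
  have hli : LinearIndependent ℂ (graphVec A) := by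
    rw [Fintype.linearIndependent_iff]
    intro g hg z
    have h := congrArg (fun v => star (graphVec A z) ⬝ᵥ v) hg
    simp only [dotProduct_sum, dotProduct_smul, dotProduct_zero] at h
    rw [Finset.sum_eq_single z, star_graphVec_dotProduct_self] at h
    · simpa [hpow] using h
    · intro z' _ hz
      have := star_graphVec_dotProduct_eq_zero hp hA hd (a := 0) (b := 0)
        (by simpa [pauliWeight] using hd0) (Or.inr hz.symm)
      rw [pauliError_zero, Matrix.one_mulVec] at this
      rw [this, smul_zero]
    · simp
  rw [graphCode, finrank_span_eq_card hli]
  simp [ZMod.card]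

theorem graphCode_detects (hp : p ≠ 2) (hA : A.IsSymm)
    (hd : ∀ s, s ≠ 0 → d + r ≤ graphWeight A s) {a b : Fin n → ZMod p}
    (hw : pauliWeight a b < d) : Detects p (graphCode A) a b := by
  rcases Nat.eq_zero_or_pos (pauliWeight a b) with h0 | h0
  · obtain ⟨rfl, rfl⟩ := pauliWeight_eq_zero h0
    refine ⟨1, fun u _ v _ => ?_, fun _ h => absurd h (by simp [pauliWeight])⟩
    rw [pauliError_zero, Matrix.one_mulVec, one_mul]
  · refine ⟨0, fun u hu v hv => ?_, fun _ _ => rfl⟩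
    obtain ⟨g, rfl⟩ := (Submodule.mem_span_range_iff_exists_fun ℂ).mp hu
    obtain ⟨g', rfl⟩ := (Submodule.mem_span_range_iff_exists_fun ℂ).mp hv
    rw [zero_mul, star_sum, sum_dotProduct, Matrix.mulVec_sum]
    refine Finset.sum_eq_zero fun z _ => ?_
    rw [dotProduct_sum]
    refine Finset.sum_eq_zero fun z' _ => ?_
    rw [star_smul, smul_dotProduct, Matrix.mulVec_smul, dotProduct_smul,
      star_graphVec_dotProduct_eq_zero hp hA hd hw (Or.inl h0), smul_zero, smul_zero]

/-- The error has a non-zero matrix entry between the vectors for `z = s ∘ Sum.inr` and `z' = 0`.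
For `r ≠ 0` these are orthogonal, so no scalar `c` can account for it; for `r = 0` the convention on
one-dimensional codes forces `c = 0`. -/
theorem graphCode_not_detects (hp : p ≠ 2) (hA : A.IsSymm) (hd0 : 0 < d)
    (hd : ∀ s, s ≠ 0 → d + r ≤ graphWeight A s) {s : Fin n ⊕ Fin r → ZMod p}
    (hs : pauliWeight (s ∘ Sum.inl) ((A *ᵥ s) ∘ Sum.inl) = d) (hr : r ≠ 0 → s ∘ Sum.inr ≠ 0) :
    ¬ Detects p (graphCode A) (s ∘ Sum.inl) ((A *ᵥ s) ∘ Sum.inl) := by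
  rintro ⟨c, hc, hc'⟩
  have hmem : ∀ z, graphVec A z ∈ graphCode A := fun z => Submodule.subset_span ⟨z, rfl⟩
  have h := hc _ (hmem (s ∘ Sum.inr)) _ (hmem 0)
  have h0 : c * (star (graphVec A (s ∘ Sum.inr)) ⬝ᵥ graphVec A 0) = 0 := by
    by_cases hr0 : r = 0
    · rw [hc' (by rw [finrank_graphCode hp hA hd0 hd, hr0, pow_zero]) (by omega), zero_mul]
    · have := star_graphVec_dotProduct_eq_zero hp hA hd (a := 0) (b := 0)
        (by simpa [pauliWeight] using hd0) (Or.inr (hr hr0))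
      rw [pauliError_zero, Matrix.one_mulVec] at this
      rw [this, mul_zero]
  rw [h0, star_graphVec_dotProduct hp hA, sub_zero, Sum.elim_comp_inl_inr, if_pos rfl] at h
  have hpow : (p : ℂ) ^ n ≠ 0 := pow_ne_zero _ (Nat.cast_ne_zero.mpr (NeZero.ne p))
  exact mul_ne_zero (by rw [ZMod.stdAddChar_apply]; exact Circle.coe_ne_zero _) hpow h

theorem isQuantumMDSCode_graphCode (hp : p ≠ 2) (hA : A.IsSymm) (hd0 : 0 < d)
    (hd : ∀ s, s ≠ 0 → d + r ≤ graphWeight A s) {s : Fin n ⊕ Fin r → ZMod p}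
    (hs : pauliWeight (s ∘ Sum.inl) ((A *ᵥ s) ∘ Sum.inl) = d) (hr : r ≠ 0 → s ∘ Sum.inr ≠ 0)
    (hn : r + 2 * d = n + 2) : IsQuantumMDSCode p (graphCode A) r d where
  finrank_eq := by rw [finrank_graphCode hp hA hd0 hd, ZMod.card]
  minDist := ⟨⟨_, _, hs, graphCode_not_detects hp hA hd0 hd hs hr⟩, by
    rintro w ⟨a, b, rfl, h⟩
    by_contra! hw
    exact h (graphCode_detects hp hA hd hw)⟩
  singleton_eq := hn

end GraphCode

/-! ### From codes over the quadratic field to symmetric matrices over the prime field. -/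

section BlockGraph

variable {p t : ℕ} [Fact p.Prime]

open QuadraticAlgebra (omega)

/-- In suitable coordinates of its two halves, the code of all `(u, M u)` is the code of all
`(s, A s)`, where `A` is the symmetric block matrix with blocks `P`, `Q`, `Qᵀ`, `R`. -/
theorem mulVec_eq_of_block {k : ℕ} {M : Matrix (Fin k) (Fin k) (QuadRing p t)}
    {P Q R : Matrix (Fin k) (Fin k) (ZMod p)} {κ : QuadRing p t}
    (h₁ : κ • Qᵀ.map (algebraMap (ZMod p) (QuadRing p t)) =
      M + (omega : QuadRing p t) • (M * P.map (algebraMap (ZMod p) (QuadRing p t))))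
    (h₂ : 1 + κ • R.map (algebraMap (ZMod p) (QuadRing p t)) =
      (omega : QuadRing p t) • (M * Q.map (algebraMap (ZMod p) (QuadRing p t))))
    (s₁ s₂ : Fin k → ZMod p) (i : Fin k) :
    (M *ᵥ fun j => (⟨s₁ j, (P *ᵥ s₁ + Q *ᵥ s₂) j⟩ : QuadRing p t)) i =
      algebraMap (ZMod p) _ (s₂ i) + κ * algebraMap (ZMod p) _ ((Qᵀ *ᵥ s₁ + R *ᵥ s₂) i) := by
  set f := algebraMap (ZMod p) (QuadRing p t) with hf
  have hu : (fun j => (⟨s₁ j, (P *ᵥ s₁ + Q *ᵥ s₂) j⟩ : QuadRing p t)) =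
      f ∘ s₁ + (omega : QuadRing p t) • (P.map f *ᵥ (f ∘ s₁) + Q.map f *ᵥ (f ∘ s₂)) := by
    ext1 j
    simp only [Pi.add_apply, Pi.smul_apply, smul_eq_mul, Function.comp_apply,
      ← RingHom.map_mulVec, ← map_add]
    ext <;> simp [hf]
  rw [hu, Matrix.mulVec_add, Matrix.mulVec_smul, Matrix.mulVec_add, Matrix.mulVec_mulVec,
    Matrix.mulVec_mulVec, smul_add, ← add_assoc, ← Matrix.smul_mulVec, ← Matrix.smul_mulVec,
    ← Matrix.add_mulVec, ← h₁, ← h₂, Matrix.add_mulVec, Matrix.one_mulVec, Matrix.smul_mulVec,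
    Matrix.smul_mulVec]
  simp only [Pi.add_apply, Pi.smul_apply, smul_eq_mul, Function.comp_apply,
    ← RingHom.map_mulVec, map_add]
  ring

/-- As `κ.im ≠ 0`, both `1, ω` and `1, κ` are bases. A coordinate of `u` or `M u` is therefore zero
exactly when `s` and `A s` both vanish there, and the two weights agree. -/
theorem lt_graphWeight_fromBlocks {k : ℕ} {M : Matrix (Fin k) (Fin k) (QuadRing p t)}
    (hM : ∀ u, u ≠ 0 → k < (Finset.univ.filter fun i => u i ≠ 0).card +
      (Finset.univ.filter fun i => (M *ᵥ u) i ≠ 0).card)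
    {P Q R : Matrix (Fin k) (Fin k) (ZMod p)} {κ : QuadRing p t} (hκ : κ.im ≠ 0)
    (h₁ : κ • Qᵀ.map (algebraMap (ZMod p) (QuadRing p t)) =
      M + (omega : QuadRing p t) • (M * P.map (algebraMap (ZMod p) (QuadRing p t))))
    (h₂ : 1 + κ • R.map (algebraMap (ZMod p) (QuadRing p t)) =
      (omega : QuadRing p t) • (M * Q.map (algebraMap (ZMod p) (QuadRing p t))))
    {s : Fin k ⊕ Fin k → ZMod p} (hs : s ≠ 0) :
    k < graphWeight (Matrix.fromBlocks P Q Qᵀ R) s := by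
  have hu : ∀ i, (⟨(s ∘ Sum.inl) i, (P *ᵥ (s ∘ Sum.inl) + Q *ᵥ (s ∘ Sum.inr)) i⟩ :
      QuadRing p t) ≠ 0 ↔ (s ∘ Sum.inl) i ≠ 0 ∨
        (P *ᵥ (s ∘ Sum.inl) + Q *ᵥ (s ∘ Sum.inr)) i ≠ 0 := by
    intro i
    rw [Ne, QuadraticAlgebra.ext_iff, not_and_or]
    rfl
  have hv := mulVec_eq_of_block h₁ h₂ (s ∘ Sum.inl) (s ∘ Sum.inr)
  have hv' : ∀ a b : ZMod p, algebraMap (ZMod p) (QuadRing p t) a +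
      κ * algebraMap (ZMod p) (QuadRing p t) b ≠ 0 ↔ a ≠ 0 ∨ b ≠ 0 := by
    intro a b
    rw [Ne, QuadraticAlgebra.ext_iff, ← not_and_or, not_iff_not]
    simp only [QuadraticAlgebra.re_add, QuadraticAlgebra.re_mul, QuadraticAlgebra.im_add,
      QuadraticAlgebra.im_mul, QuadraticAlgebra.algebraMap_re, QuadraticAlgebra.algebraMap_im,
      QuadraticAlgebra.re_zero, QuadraticAlgebra.im_zero, mul_zero, add_zero, zero_add]
    constructor
    · rintro ⟨h, h'⟩
      have hb := (mul_eq_zero.mp h').resolve_left hκ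
      rw [hb, mul_zero, add_zero] at h
      exact ⟨h, hb⟩
    · rintro ⟨rfl, rfl⟩
      simp
  rw [graphWeight_sum, Matrix.fromBlocks_mulVec, Sum.elim_comp_inl, Sum.elim_comp_inr]
  have h := hM (fun i => ⟨(s ∘ Sum.inl) i, (P *ᵥ (s ∘ Sum.inl) + Q *ᵥ (s ∘ Sum.inr)) i⟩) (by
    intro h0
    have h1 : s ∘ Sum.inl = 0 := by
      ext i
      exact congrArg QuadraticAlgebra.re (congrFun h0 i)
    have h2 : s ∘ Sum.inr = 0 := by
      ext i
      have := hv i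
      rw [h0, Matrix.mulVec_zero] at this
      by_contra hi
      exact (hv' _ _).mpr (Or.inl hi) this.symm
    apply hs
    rw [← Sum.elim_comp_inl_inr s, h1, h2]
    ext (i | i) <;> rfl)
  simp only [hv, hv', hu] at h
  exact h

theorem graphWeight_submatrix {ι κ : Type*} [Fintype ι] [Fintype κ] (A : Matrix ι ι (ZMod p))
    (e : κ ≃ ι) (s : κ → ZMod p) :
    graphWeight (A.submatrix e e) s = graphWeight A (s ∘ e.symm) := by
  simp only [graphWeight, Finset.card_filter]
  rw [← Equiv.sum_comp e]
  simp [Matrix.submatrix_mulVec_equiv]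

theorem pauliWeight_of_forall_ne_zero {n : ℕ} {a b : Fin n → ZMod p} (ha : ∀ i, a i ≠ 0) :
    pauliWeight a b = n := by
  rw [pauliWeight, Finset.filter_true_of_mem fun i _ => Or.inl (ha i), Finset.card_univ,
    Fintype.card_fin]

/-- Codes of length `2 k - r` from a symmetric matrix of size `2 k` such that all `(s, A s)`,
`s ≠ 0`, have weight more than `k`. -/
theorem exists_isQuantumMDSCode (hp : p ≠ 2) {k : ℕ}
    {A : Matrix (Fin k ⊕ Fin k) (Fin k ⊕ Fin k) (ZMod p)} (hA : A.IsSymm)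
    (hw : ∀ s, s ≠ 0 → k < graphWeight A s) {s : Fin k ⊕ Fin k → ZMod p}
    (hs : pauliWeight (s ∘ Sum.inl) ((A *ᵥ s) ∘ Sum.inl) = 1)
    (hs₀ : ∀ i, (s ∘ Sum.inr) i ≠ 0)
    {r : ℕ} (hr : r < k) :
    ∃ Q : Submodule ℂ ((Fin (2 * k - r) → ZMod p) → ℂ), IsQuantumMDSCode p Q r (k + 1 - r) := by
  have hn : 2 * k - r = k + (k - r) := by omega
  have hkr : (k - r) + r = k := by omega
  rw [hn]
  -- The `r` projected systems are the last `r` of the right half, where `s` has no zero.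
  let e : Fin (k + (k - r)) ⊕ Fin r ≃ Fin k ⊕ Fin k :=
    (finSumFinEquiv.symm.sumCongr (Equiv.refl _)).trans
      ((Equiv.sumAssoc _ _ _).trans
        ((Equiv.refl _).sumCongr (finSumFinEquiv.trans (finCongr hkr))))
  have he : ∀ j, ∃ i, e (Sum.inr j) = Sum.inr i := fun j => ⟨_, rfl⟩
  have htotal : graphWeight (A.submatrix e e) (s ∘ e) = k + 1 := by
    rw [graphWeight_submatrix, Function.comp_assoc, Equiv.self_comp_symm, Function.comp_id,
      graphWeight_sum, hs, pauliWeight_of_forall_ne_zero hs₀, add_comm]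
  have hright : pauliWeight ((s ∘ e) ∘ Sum.inr)
      (((A.submatrix e e) *ᵥ (s ∘ e)) ∘ Sum.inr) = r := by
    refine pauliWeight_of_forall_ne_zero fun j => ?_
    obtain ⟨i, hi⟩ := he j
    simp only [Function.comp_apply, hi]
    exact hs₀ i
  refine ⟨_, isQuantumMDSCode_graphCode (A := A.submatrix e e) (s := s ∘ e) hp (hA.submatrix e)
    (by omega) (fun w hw0 => ?_) ?_ (fun hr0 h0 => ?_) (by omega)⟩
  · rw [graphWeight_submatrix]
    have := hw (w ∘ e.symm) fun h => hw0 (by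
      rw [← Function.comp_id w, ← Equiv.symm_comp_self e, ← Function.comp_assoc, h]; rfl)
    omega
  · have := graphWeight_sum (A := A.submatrix e e) (s ∘ e)
    rw [htotal, hright] at this
    omega
  · obtain ⟨i, hi⟩ := he ⟨0, by omega⟩
    have := congrFun h0 ⟨0, by omega⟩
    simp only [Function.comp_apply, hi] at this
    exact hs₀ i this

end BlockGraph

/-! ### From the checks to the circulant condition and the weight bound. -/

section Check

variable {p t : ℕ}

theorem card_quadRing : Nat.card (QuadRing p t) = p ^ 2 := by
  rw [Nat.card_congr (QuadraticAlgebra.equivProd _ _), Nat.card_prod, Nat.card_zmod, sq]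

variable [Fact p.Prime] {S T : ℕ} {x : Fin 9 → QuadRing p t}

theorem minor_ne_zero_of_check (hx : IsTable S T x) (h₁ : ∀ i, x i ≠ 0)
    (h₂ : checkMinors₂ p t S T = true) (h₃ : checkMinors₃ p t S T = true)
    (h₄ : checkMinors₄ p t S T = true) (m : ℕ) (hm : 1 ≤ m) (hm' : m ≤ 9 / 2)
    (r c : Fin m ↪o Fin 9) : ((circ x).submatrix r c).det ≠ 0 := by
  have hp : 1 ≤ p := (Fact.out : p.Prime).one_le
  have hm'' : m ≤ 4 := hm'
  interval_cases m
  · rw [Matrix.det_fin_one]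
    exact h₁ _
  · exact circ_minor_ne_zero_of_first_row (fun _ _ hr hc => minor₂_ne_zero hp hx h₂ hr hc)
      r.strictMono c.injective
  · exact circ_minor_ne_zero_of_first_row (fun _ _ hr hc => minor₃_ne_zero hp hx h₃ hr hc)
      r.strictMono c.injective
  · exact circ_minor_ne_zero_of_first_row (fun _ _ hr hc => minor₄_ne_zero hp hx h₄ hr hc)
      r.strictMono c.injective

variable [Fact (∀ r : ZMod p, r ^ 2 ≠ (t : ZMod p) + 1 * r)]

/-- The inverse of `circ x` is, up to a factor, its conjugate, whose minors are the conjugates of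
those of `circ x`. -/
theorem lt_card_add_card_of_circulantCondition {q : ℕ} (hx : CirculantCondition q x)
    {a : QuadRing p t} (ha : a ≠ 0) (h : (circ x).map star * circ x = a • 1)
    {u : Fin 9 → QuadRing p t} (hu : u ≠ 0) :
    9 < (Finset.univ.filter fun i => u i ≠ 0).card +
      (Finset.univ.filter fun i => (circ x *ᵥ u) i ≠ 0).card := by
  refine lt_card_add_card_of_mul_eq_smul_one ha h hx.minor_ne_zero (fun m hm hm' r c => ?_) hu
  have e : ((circ x).map star).submatrix r c =
      (starRingEnd (QuadRing p t)).mapMatrix ((circ x).submatrix r c) := rfl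
  rw [e, ← RingHom.map_det]
  exact (map_ne_zero _).mpr (hx.minor_ne_zero m hm hm' r c)

end Check

/-! ### Transport of the circulant condition along field homomorphisms. -/

section Transport

variable {K L : Type*} [Field K] [Field L] {k : ℕ}

theorem det_ne_zero_of_mul_eq_smul_one {M M' : Matrix (Fin k) (Fin k) K} {a : K} (ha : a ≠ 0)
    (h : M' * M = a • 1) : M.det ≠ 0 := by
  intro h0
  have := congrArg Matrix.det h
  rw [Matrix.det_mul, h0, mul_zero, Matrix.det_smul, Matrix.det_one, mul_one] at this
  exact pow_ne_zero _ ha this.symm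

variable [NeZero k]

theorem CirculantCondition.map {q : ℕ} {x : Fin k → K} (hx : CirculantCondition q x) (φ : K →+* L)
    (hL : Nat.card L = q ^ 2) : CirculantCondition q (φ ∘ x) where
  card_eq := hL
  det_ne_zero := by
    have e : circ (φ ∘ x) = φ.mapMatrix (circ x) := rfl
    rw [e, ← RingHom.map_det]
    exact (map_ne_zero φ).mpr hx.det_ne_zero
  minor_ne_zero m hm hm' r c := by
    have e : (circ (φ ∘ x)).submatrix r c = φ.mapMatrix ((circ x).submatrix r c) := rfl
    rw [e, ← RingHom.map_det]
    exact (map_ne_zero φ).mpr (hx.minor_ne_zero m hm hm' r c)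
  hermSum_eq_zero m hm hm' := by
    have e : hermSum q m (φ ∘ x) = φ (hermSum q m x) := by simp [hermSum]
    rw [e, hx.hermSum_eq_zero m hm hm', map_zero]
  sum_pow_ne_zero := by
    have e : ∑ i, (φ ∘ x) i ^ (q + 1) = φ (∑ i, x i ^ (q + 1)) := by simp
    rw [e]
    exact (map_ne_zero φ).mpr hx.sum_pow_ne_zero

end Transport

/-! ### The two explicit matrices and their codes. -/

section Examples

open QuadraticAlgebra (omega)

/-- Since `X ^ 2 - X - 3` has no root modulo `5`, `QuadRing 5 3` is a field; likewise below for `X ^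
2 - X - 4` modulo `7`. -/
instance fact_sq_ne_five : Fact (∀ r : ZMod 5, r ^ 2 ≠ ((3 : ℕ) : ZMod 5) + 1 * r) := ⟨by decide⟩

instance fact_sq_ne_seven : Fact (∀ r : ZMod 7, r ^ 2 ≠ ((4 : ℕ) : ZMod 7) + 1 * r) := ⟨by decide⟩

/-- The first row of the circulant matrix over the field with `25` elements. -/
def vec₅ : Fin 9 → QuadRing 5 3 :=
  ![⟨1, 0⟩, ⟨2, 4⟩, ⟨4, 2⟩, ⟨3, 3⟩, ⟨4, 1⟩, ⟨4, 1⟩, ⟨3, 3⟩, ⟨4, 2⟩, ⟨2, 4⟩]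

theorem vec₅_eq : vec₅ = ![1, omega ^ 14, omega ^ 21, omega ^ 16, omega ^ 17, omega ^ 17,
    omega ^ 16, omega ^ 21, omega ^ 14] := by
  decide +kernel

theorem circ_vec₅_mul : (circ vec₅).map star * circ vec₅ = (4 : QuadRing 5 3) • 1 := by
  decide +kernel

theorem circulantCondition_vec₅ : CirculantCondition 5 vec₅ where
  card_eq := card_quadRing
  det_ne_zero := det_ne_zero_of_mul_eq_smul_one (by decide) circ_vec₅_mul
  minor_ne_zero := minor_ne_zero_of_check (S := 5755086702528273) (T := 9680877832148640)
    (by unfold IsTable; decide +kernel) (by decide +kernel) (by decide +kernel) (by decide +kernel)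
    (by decide +kernel)
  hermSum_eq_zero m hm hm' := by
    have h : ∀ m, 1 ≤ m → m ≤ 9 / 2 → hermSum 5 m vec₅ = 0 := by decide +kernel
    exact h m hm hm'
  sum_pow_ne_zero := by decide +kernel

theorem exists_isQuantumMDSCode₅ {r : ℕ} (hr : r < 9) :
    ∃ Q : Submodule ℂ ((Fin (18 - r) → ZMod 5) → ℂ), IsQuantumMDSCode 5 Q r (10 - r) := by
  let P : Matrix (Fin 9) (Fin 9) (ZMod 5) := circ ![4, 2, 0, 3, 1, 1, 3, 0, 2]
  let Q : Matrix (Fin 9) (Fin 9) (ZMod 5) := circ ![4, 1, 0, 2, 1, 1, 2, 0, 1]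
  let R : Matrix (Fin 9) (Fin 9) (ZMod 5) := circ ![0, 4, 0, 1, 2, 2, 1, 0, 4]
  have hA : (Matrix.fromBlocks P Q Qᵀ R).IsSymm :=
    Matrix.IsSymm.fromBlocks (by decide +kernel) rfl (by decide +kernel)
  exact exists_isQuantumMDSCode (by decide) hA
    (fun _ => lt_graphWeight_fromBlocks (M := circ vec₅)
      (fun _ => lt_card_add_card_of_circulantCondition circulantCondition_vec₅
        (by decide) circ_vec₅_mul)
      -- Here `κ.im = 1 = -4`, with `4` the scalar of `circ_vec₅_mul`.
      (κ := ⟨1, 1⟩) (by decide) (by decide +kernel) (by decide +kernel))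
    -- This comes from `u = (1 + 3 ω) e₀`: the right half lists the first coordinates of `M u` in
    -- the basis `1, κ`.
    (s := Sum.elim (Pi.single 0 1) ![3, 1, 2, 4, 2, 2, 4, 2, 1])
    (by decide +kernel) (by decide +kernel) hr

/-- The first row of the circulant matrix over the field with `49` elements. -/
def vec₇ : Fin 9 → QuadRing 7 4 :=
  ![⟨1, 0⟩, ⟨4, 6⟩, ⟨4, 1⟩, ⟨0, 2⟩, ⟨3, 3⟩, ⟨3, 3⟩, ⟨0, 2⟩, ⟨4, 1⟩, ⟨4, 6⟩]

theorem vec₇_eq : vec₇ = ![1, omega ^ 12, omega ^ 2, omega ^ 17, omega ^ 13,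
    omega ^ 13, omega ^ 17, omega ^ 2, omega ^ 12] := by
  decide +kernel

theorem circ_vec₇_mul : (circ vec₇).map star * circ vec₇ = (2 : QuadRing 7 4) • 1 := by
  decide +kernel

theorem circulantCondition_vec₇ : CirculantCondition 7 vec₇ where
  card_eq := card_quadRing
  det_ne_zero := det_ne_zero_of_mul_eq_smul_one (by decide) circ_vec₇_mul
  minor_ne_zero := minor_ne_zero_of_check (S := 10147981433090337) (T := 13877638584710256)
    (by unfold IsTable; decide +kernel) (by decide +kernel) (by decide +kernel) (by decide +kernel)
    (by decide +kernel)
  hermSum_eq_zero m hm hm' := by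
    have h : ∀ m, 1 ≤ m → m ≤ 9 / 2 → hermSum 7 m vec₇ = 0 := by decide +kernel
    exact h m hm hm'
  sum_pow_ne_zero := by decide +kernel

theorem exists_isQuantumMDSCode₇ {r : ℕ} (hr : r < 9) :
    ∃ Q : Submodule ℂ ((Fin (18 - r) → ZMod 7) → ℂ), IsQuantumMDSCode 7 Q r (10 - r) := by
  let P : Matrix (Fin 9) (Fin 9) (ZMod 7) := circ ![6, 6, 5, 5, 6, 6, 5, 5, 6]
  let Q : Matrix (Fin 9) (Fin 9) (ZMod 7) := circ ![6, 4, 3, 4, 5, 5, 4, 3, 4]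
  let R : Matrix (Fin 9) (Fin 9) (ZMod 7) := circ ![2, 3, 6, 6, 3, 3, 6, 6, 3]
  have hA : (Matrix.fromBlocks P Q Qᵀ R).IsSymm :=
    Matrix.IsSymm.fromBlocks (by decide +kernel) rfl (by decide +kernel)
  exact exists_isQuantumMDSCode (by decide) hA
    (fun _ => lt_graphWeight_fromBlocks (M := circ vec₇)
      (fun _ => lt_card_add_card_of_circulantCondition circulantCondition_vec₇
        (by decide) circ_vec₇_mul)
      -- Here `κ.im = 5 = -2`, with `2` the scalar of `circ_vec₇_mul`.
      (κ := ⟨0, 5⟩) (by decide) (by decide +kernel) (by decide +kernel))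
    -- This comes from `u = (1 + 2 ω) e₀` in the same way.
    (s := Sum.elim (Pi.single 0 1) ![1, 3, 5, 2, 6, 6, 2, 5, 3])
    (by decide +kernel) (by decide +kernel) hr

end Examples

/-! ### Roots of `X ^ 2 - X - t` in the field with `p ^ 2` elements. -/

section GaloisField

variable {p t : ℕ} [Fact p.Prime]

/-- A root of `X ^ 2 - X - t` in an extension of `ZMod p` gives a homomorphism from the quadratic
ring, which maps `ω` to the root. -/
theorem exists_ringHom_omega {L : Type*} [Field L] [Algebra (ZMod p) L] {ε : L}
    (hε : ε ^ 2 = ε + t) :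
    ∃ φ : QuadRing p t →+* L, φ QuadraticAlgebra.omega = ε := by
  have h : ε * ε = (t : ZMod p) • 1 + (1 : ZMod p) • ε := by
    rw [← sq, hε, one_smul, Algebra.smul_def, map_natCast, mul_one, add_comm]
  exact ⟨(QuadraticAlgebra.lift ⟨ε, h⟩ : QuadRing p t →ₐ[ZMod p] L), by simp⟩

/-- `X ^ 2 - X - t` has a root in the field with `p ^ 2` elements where its discriminant satisfies
Euler's criterion. -/
theorem exists_sq_eq_add (hp : p ≠ 2) (h0 : (1 + 4 * t : ZMod p) ≠ 0)
    (h : (1 + 4 * t : ZMod p) ^ (p ^ 2 / 2) = 1) : ∃ ε : GaloisField p 2, ε ^ 2 = ε + t := by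
  have h2 : ringChar (GaloisField p 2) ≠ 2 := by
    rwa [← Algebra.ringChar_eq (ZMod p) (GaloisField p 2), ZMod.ringChar_zmod_n]
  have := Fintype.ofFinite (GaloisField p 2)
  have hd : algebraMap (ZMod p) (GaloisField p 2) (1 + 4 * t) = 1 + 4 * t := by
    rw [map_add, map_mul, map_one, map_natCast, map_ofNat]
  obtain ⟨s, hs⟩ := (FiniteField.isSquare_iff h2 
    ((map_ne_zero (algebraMap (ZMod p) (GaloisField p 2))).mpr h0)).mpr (by
    rw [← Nat.card_eq_fintype_card, GaloisField.card p 2 two_ne_zero, ← map_pow, h,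
      map_one])
  rw [hd] at hs
  have h2' : (2 : GaloisField p 2) ≠ 0 := Ring.two_ne_zero h2
  refine ⟨(1 + s) / 2, ?_⟩
  field_simp
  linear_combination -hs

end GaloisField

end QuantumMDS

theorem mainTheorem10 :
    -- the matrix over the field with 25 elements
    ((∃ ε : GaloisField 5 2, ε ^ 2 = ε + 3) ∧
      ∀ ε : GaloisField 5 2, ε ^ 2 = ε + 3 → ∀ x : Fin 9 → GaloisField 5 2,
        x = ![1, ε ^ 14, ε ^ 21, ε ^ 16, ε ^ 17, ε ^ 17, ε ^ 16, ε ^ 21, ε ^ 14] →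
        (QuantumMDS.circ x).IsSymm ∧ QuantumMDS.CirculantCondition 5 x) ∧
    -- the matrix over the field with 49 elements
    ((∃ ε : GaloisField 7 2, ε ^ 2 = ε + 4) ∧
      ∀ ε : GaloisField 7 2, ε ^ 2 = ε + 4 → ∀ x : Fin 9 → GaloisField 7 2,
        x = ![1, ε ^ 12, ε ^ 2, ε ^ 17, ε ^ 13, ε ^ 13, ε ^ 17, ε ^ 2, ε ^ 12] →
        (QuantumMDS.circ x).IsSymm ∧ QuantumMDS.CirculantCondition 7 x) ∧
    -- the quantum codes; `r = 0` gives the parameters `[[18, 0, 10]]`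
    (∀ r : ℕ, r ≤ 8 → ∃ Q : Submodule ℂ ((Fin (18 - r) → ZMod 5) → ℂ),
      QuantumMDS.IsQuantumMDSCode 5 Q r (10 - r)) ∧
    (∀ r : ℕ, r ≤ 8 → ∃ Q : Submodule ℂ ((Fin (18 - r) → ZMod 7) → ℂ),
      QuantumMDS.IsQuantumMDSCode 7 Q r (10 - r)) := by
  refine ⟨?_, ?_, fun r hr => QuantumMDS.exists_isQuantumMDSCode₅ (by omega),
    fun r hr => QuantumMDS.exists_isQuantumMDSCode₇ (by omega)⟩
  · have hroot := QuantumMDS.exists_sq_eq_add (p := 5) (t := 3) (by decide) (by decide) (by decide)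
    refine ⟨by exact_mod_cast hroot, fun ε hε x hx => ?_⟩
    obtain ⟨φ, hφ⟩ := QuantumMDS.exists_ringHom_omega (p := 5) (t := 3) (ε := ε)
      (by exact_mod_cast hε)
    have e : x = φ ∘ QuantumMDS.vec₅ := by
      rw [hx, QuantumMDS.vec₅_eq]
      ext i
      fin_cases i <;> simp [hφ]
    rw [e]
    refine ⟨?_, QuantumMDS.circulantCondition_vec₅.map φ (GaloisField.card 5 2 two_ne_zero)⟩
    exact Matrix.IsSymm.map (show (QuantumMDS.circ QuantumMDS.vec₅).IsSymm by decide +kernel) φ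
  · have hroot := QuantumMDS.exists_sq_eq_add (p := 7) (t := 4) (by decide) (by decide) (by decide)
    refine ⟨by exact_mod_cast hroot, fun ε hε x hx => ?_⟩
    obtain ⟨φ, hφ⟩ := QuantumMDS.exists_ringHom_omega (p := 7) (t := 4) (ε := ε)
      (by exact_mod_cast hε)
    have e : x = φ ∘ QuantumMDS.vec₇ := by
      rw [hx, QuantumMDS.vec₇_eq]
      ext i
      fin_cases i <;> simp [hφ]
    rw [e]
    refine ⟨?_, QuantumMDS.circulantCondition_vec₇.map φ (GaloisField.card 7 2 two_ne_zero)⟩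
    exact Matrix.IsSymm.map (show (QuantumMDS.circ QuantumMDS.vec₇).IsSymm by decide +kernel) φ
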